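/- Graphs are finite and may have parallel edges. The line graph $L(H)$ of a graph $H$ has the edges of $H$ as nodes, two distinct edges being adjacent if they share an end (so parallel edges are adjacent). For a simple graph $G=(V,E)$ let $\mathrm{STAB}(G)$ be the convex hull of the incidence vectors of its stable sets and $\mathrm{ESTAB}(G)=\{x\in\mathbb{R}^V: x\ge 0,\ x_i+x_j\le 1 \text{ for all } ij\in E\}$. For $K\subseteq\mathbb{R}^V$ let $\mathrm{cone}(K)=\{(x_0,x): x_0\ge 0,\ x=x_0y \text{ for some } y\in K\}$, and let $N_+(K)$ be the set of all $x\in[0,1]^V$ such that $(1,x)^T=Ye_0$ for some symmetric positive semidefinite real matrix $Y$ indexed by $\{0\}\cup V$ with $Ye_0=\mathrm{diag}(Y)$ and $Ye_i,\ Y(e_0-e_i)\in\mathrm{cone}(K)$ for all $i\in V$. The graph $G$ is $N_+$-perfect if $N_+(\mathrm{ESTAB}(G))=\mathrm{STAB}(G)$, and $N_+$-imperfect otherwise. An odd hole is a chordless cycle $C_{2k+1}$ with $k\ge 2$. Theorem. The line graph $L(H)$ is $N_+$-imperfect if $H$ is one of the following graphs: (i) an odd hole with one double edge, that is, an odd hole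 $C$ together with one additional edge parallel to an edge of $C$; (ii) an odd hole with one chord, that is, an odd hole $C$ together with one additional edge joining two distinct non-adjacent nodes of $C$; (iii) an odd hole with one odd path attached to non-adjacent nodes, that is, the union of an odd hole $C$ and a path of odd length whose ends are two distinct non-adjacent nodes of $C$ and which has no other node and no edge in common with $C$. -/

import Mathlib

open scoped Graph

/-! ### Stable set polytope, edge relaxation and the operator `N₊` -/

/-- The stable set polytope `STAB(G)`: the convex hull of the incidence vectors of the
stable sets of `G`. -/
def SimpleGraph.stab {ι : Type*} (G : SimpleGraph ι) : Set (ι → ℝ) :=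
  convexHull ℝ {x | ∃ S : Set ι, G.IsIndepSet S ∧ x = S.indicator 1}

/-- The edge constraint stable set polytope `ESTAB(G)`. -/
def SimpleGraph.estab {ι : Type*} (G : SimpleGraph ι) : Set (ι → ℝ) :=
  {x | (∀ i, 0 ≤ x i) ∧ ∀ i j, G.Adj i j → x i + x j ≤ 1}

/-- `cone(K)`, consisting of the vectors `(x₀, x₀ y)` with `x₀ ≥ 0` and `y ∈ K`. The additional
coordinate with index zero is `none`. -/
def homCone {ι : Type*} (K : Set (ι → ℝ)) : Set (Option ι → ℝ) :=
  {z | 0 ≤ z none ∧ ∃ y ∈ K, ∀ i, z (some i) = z none * y i}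

/-- The lifting `M₊(K)`: positive semidefinite symmetric matrices `Y`, indexed by `0` (that is,
`none`) and the coordinates, with `Y e₀ = diag Y`, `Y eᵢ ∈ cone(K)` and `Y (e₀ - eᵢ) ∈ cone(K)`.
Here `Y eᵢ` is the column of `Y` with index `i`. -/
def MPlus {ι : Type*} (K : Set (ι → ℝ)) : Set (Matrix (Option ι) (Option ι) ℝ) :=
  {Y | Y.PosSemidef ∧ (∀ a, Y a none = Y a a) ∧
    ∀ i : ι, (fun a => Y a (some i)) ∈ homCone K ∧
      (fun a => Y a none - Y a (some i)) ∈ homCone K}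

/-- `N₊(K)`: all `x ∈ [0,1]^ι` with `(1, x) = Y e₀` for some `Y ∈ M₊(K)`. -/
def NPlus {ι : Type*} (K : Set (ι → ℝ)) : Set (ι → ℝ) :=
  {x | (∀ i, x i ∈ Set.Icc (0 : ℝ) 1) ∧
    ∃ Y ∈ MPlus K, Y none none = 1 ∧ ∀ i, Y (some i) none = x i}

/-- `G` is `N₊`-perfect if `N₊(ESTAB(G)) = STAB(G)`. -/
def SimpleGraph.IsNPlusPerfect {ι : Type*} (G : SimpleGraph ι) : Prop :=
  NPlus G.estab = G.stab

/-- `G` is `N₊`-imperfect if it is not `N₊`-perfect. -/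
def SimpleGraph.IsNPlusImperfect {ι : Type*} (G : SimpleGraph ι) : Prop :=
  ¬ G.IsNPlusPerfect

/-! ### Line graphs and the three families of multigraphs -/

/-- The line graph `L(H)` of a multigraph `H`: its nodes are the edges of `H`, and two distinct
edges are adjacent if they have a common end. In particular, parallel edges are adjacent. -/
def Graph.lineGraph {α β : Type*} (H : Graph α β) : SimpleGraph E(H) where
  Adj e f := e ≠ f ∧ ∃ x, H.Inc e x ∧ H.Inc f x
  symm := ⟨fun _ _ ⟨hne, x, he, hf⟩ => ⟨hne.symm, x, hf, he⟩⟩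
  loopless := ⟨fun _ h => h.1 rfl⟩

/-- `C` is an odd hole: the chordless cycle with `2k+1` nodes for some `k ≥ 2`. It has no edges
other than the edges `e i` of the cycle. -/
def Graph.IsOddHole {α β : Type*} (C : Graph α β) : Prop :=
  ∃ k : ℕ, 2 ≤ k ∧ ∃ (v : ZMod (2 * k + 1) → α) (e : ZMod (2 * k + 1) → β),
    Function.Injective v ∧ Function.Injective e ∧
    V(C) = Set.range v ∧ E(C) = Set.range e ∧ ∀ i, C.IsLink (e i) (v i) (v (i + 1))

/-- `P` is a path with `l` edges from `x` to `y` (and has no other nodes or edges). -/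
def Graph.IsPathOfLength {α β : Type*} (P : Graph α β) (l : ℕ) (x y : α) : Prop :=
  ∃ (p : Fin (l + 1) → α) (f : Fin l → β),
    Function.Injective p ∧ Function.Injective f ∧
    V(P) = Set.range p ∧ E(P) = Set.range f ∧
    (∀ i : Fin l, P.IsLink (f i) (p i.castSucc) (p i.succ)) ∧
    p 0 = x ∧ p (Fin.last l) = y

/-- `H` is an odd hole `C` with one double edge: it arises from `C` by adding one edge `d` parallel
to an edge of `C`. -/
def Graph.IsOddHoleWithDoubleEdge {α β : Type*} (H : Graph α β) : Prop :=
  ∃ C : Graph α β, C ≤ H ∧ C.IsOddHole ∧ ∃ d x y,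
    d ∉ E(C) ∧ C.Adj x y ∧ H.IsLink d x y ∧ V(H) = V(C) ∧ E(H) = insert d E(C)

/-- `H` is an odd hole `C` with one chord: it arises from `C` by adding one edge `c` between two
distinct non-adjacent nodes of `C`. -/
def Graph.IsOddHoleWithChord {α β : Type*} (H : Graph α β) : Prop :=
  ∃ C : Graph α β, C ≤ H ∧ C.IsOddHole ∧ ∃ c x y,
    c ∉ E(C) ∧ x ∈ V(C) ∧ y ∈ V(C) ∧ x ≠ y ∧ ¬ C.Adj x y ∧ H.IsLink c x y ∧
    V(H) = V(C) ∧ E(H) = insert c E(C)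

/-- `H` is an odd hole `C` with one odd path attached to two distinct non-adjacent nodes `x`, `y`
of `C`: it is the union of `C` and a path `P` of odd length from `x` to `y` that shares with `C`
only the nodes `x` and `y`. -/
def Graph.IsOddHoleWithOddPath {α β : Type*} (H : Graph α β) : Prop :=
  ∃ C P : Graph α β, C ≤ H ∧ P ≤ H ∧ C.IsOddHole ∧ ∃ (l : ℕ) (x y : α),
    Odd l ∧ P.IsPathOfLength l x y ∧ x ∈ V(C) ∧ y ∈ V(C) ∧ x ≠ y ∧ ¬ C.Adj x y ∧
    V(C) ∩ V(P) = {x, y} ∧ E(C) ∩ E(P) = ∅ ∧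
    V(H) = V(C) ∪ V(P) ∧ E(H) = E(C) ∪ E(P)

open scoped Matrix

/-!
Each of the three families consists of theta graphs: two nodes joined by three internally disjoint
paths, one of even length and two of odd length, where the lengths are not `1, 1, 2`. Such a graph
has an odd number `2 k + 2 r + 1` of nodes, so a matching has at most `k + r` edges, and the sum of
all coordinates is at most `k + r` on the stable set polytope of the line graph
(`Graph.IsTheta.sum_le_of_mem_stab`). It is therefore enough to find a point of `N₊(ESTAB)` whose
coordinates have a larger sum.

For the smallest theta graphs, with path lengths `1, 1, 4` and `3, 1, 2`, such a point comes from
an explicit positive semidefinite matrix of order seven (`gadgetDouble`, `gadgetChord`). All others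
arise from these two by replacing an edge by a path of three edges, repeatedly. This operation
lifts matrices of `M₊`: if the edge carries the coordinate `x`, let the three new edges carry `x`,
`1 - x`, `x`, and transform the matrix accordingly to `A M Aᵀ`. The sum of the coordinates and the
bound `k + r` both increase by one. All subdivisions are carried out at once here: every edge of
the theta graph is labelled by a coordinate or the complement of a coordinate of the small matrix
(a `Literal`), and only the compatibility of the labels at each node has to be checked
(`IsGadget.mem_nPlus_estab`, `Graph.IsTheta.isNPlusImperfect_of_labelling`).
-/

/-! ### Lifting a matrix along literals -/

/-- A literal over the six coordinates `1, …, 6` of a matrix with rows `0, …, 6`: `(i, true)` stands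
for the unit vector `eᵢ` and `(i, false)` for its complement `e₀ - eᵢ`. In particular `(0, true)`
stands for `e₀`. -/
abbrev Literal : Type := Fin 7 × Bool

namespace Literal

/-- The complementary literal. -/
def neg (p : Literal) : Literal := (p.1, !p.2)

/-- The value `e₀` or `eᵢ` or `e₀ - eᵢ` of a literal at a linear functional with coordinates `z`. -/
def val {R : Type*} [Sub R] (p : Literal) (z : Fin 7 → R) : R :=
  if p.2 then z p.1 else z 0 - z p.1

/-- The value `uᵀ M w` of the bilinear form with matrix `M` at the vectors `u`, `w` that the
literals `p`, `q` stand for. -/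
def form {R : Type*} [Sub R] (M : Matrix (Fin 7) (Fin 7) R) (p q : Literal) : R :=
  p.val fun i => q.val (M i)

/-- Two literals are compatible for `M` if their sum satisfies the edge constraint in every
column of `M` and in every complementary column. -/
def Compat (M : Matrix (Fin 7) (Fin 7) ℤ) (p q : Literal) : Prop :=
  ∀ r, form M p r + form M q r ≤ form M (0, true) r

instance (M : Matrix (Fin 7) (Fin 7) ℤ) (p q : Literal) : Decidable (Compat M p q) :=
  inferInstanceAs (Decidable (∀ _, _))

lemma Compat.symm {M : Matrix (Fin 7) (Fin 7) ℤ} {p q : Literal} (h : Compat M p q) :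
    Compat M q p := fun r => by rw [add_comm]; exact h r

lemma form_add_form_neg (M : Matrix (Fin 7) (Fin 7) ℤ) (p r : Literal) :
    form M p r + form M p.neg r = form M (0, true) r := by
  obtain ⟨i, _ | _⟩ := p <;> simp [form, val, neg]

lemma form_neg_right (M : Matrix (Fin 7) (Fin 7) ℤ) (p r : Literal) :
    form M p r.neg = form M p (0, true) - form M p r := by
  obtain ⟨i, _ | _⟩ := p <;> obtain ⟨j, _ | _⟩ := r <;> (simp [form, val, neg]; try ring)

lemma compat_neg (M : Matrix (Fin 7) (Fin 7) ℤ) (p : Literal) : Compat M p p.neg :=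
  fun r => (form_add_form_neg M p r).le

/-- The vector that a literal stands for. -/
def vec (p : Literal) : Fin 7 → ℝ :=
  if p.2 then Pi.single p.1 1 else Pi.single 0 1 - Pi.single p.1 1

lemma vec_dotProduct (p : Literal) (z : Fin 7 → ℝ) : p.vec ⬝ᵥ z = p.val z := by
  obtain ⟨i, _ | _⟩ := p <;> simp [vec, val, sub_dotProduct]

lemma form_map_cast (M : Matrix (Fin 7) (Fin 7) ℤ) (p q : Literal) :
    form (M.map (Int.cast : ℤ → ℝ)) p q = form M p q := by
  obtain ⟨i, _ | _⟩ := p <;> obtain ⟨j, _ | _⟩ := q <;> simp [form, val]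

end Literal

open Literal

/-- A matrix `M` which, after division by `M 0 0`, behaves like a member of `M₊` as far as the
conditions on single coordinates are concerned. The edge constraints are the subject of
`Literal.Compat`. -/
structure IsGadget (M : Matrix (Fin 7) (Fin 7) ℤ) : Prop where
  pos : 0 < M 0 0
  posSemidef : (M.map (Int.cast : ℤ → ℝ)).PosSemidef
  nonneg : ∀ p q, 0 ≤ form M p q
  diag : ∀ p, form M p (0, true) = form M p p

/-- The upper bounds by `z none` guarantee that `z` vanishes if its coordinate `none` does. -/
lemma mem_homCone_estab {ι : Type*} {G : SimpleGraph ι} {z : Option ι → ℝ}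
    (h0 : ∀ i, 0 ≤ z (some i)) (h1 : ∀ i, z (some i) ≤ z none) (hz : 0 ≤ z none)
    (hadj : ∀ i j, G.Adj i j → z (some i) + z (some j) ≤ z none) : z ∈ homCone G.estab := by
  refine ⟨hz, fun i => z (some i) / z none, ⟨fun i => div_nonneg (h0 i) hz, fun i j hij => ?_⟩,
    fun i => ?_⟩
  · rw [← add_div]
    exact div_le_one_of_le₀ (hadj i j hij) hz
  · rcases hz.eq_or_lt with h | h
    · -- here the quotient is the junk value `0`, and so is `z (some i)`
      have := h0 i
      have := h1 i
      simp only [← h, zero_mul]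
      linarith
    · field_simp

/-- Assigning to every node of `G` a literal, with compatible literals at adjacent nodes, lifts a
gadget `M` to a member of `M₊(ESTAB(G))`: the matrix `A M Aᵀ`, where the rows of `A` are the
vectors of the literals. This is the only place where semidefiniteness is used, and it makes
subdividing edges by alternating complementary literals free of charge. -/
lemma IsGadget.mem_nPlus_estab {M : Matrix (Fin 7) (Fin 7) ℤ} (hM : IsGadget M) {ι : Type*}
    [Finite ι] {G : SimpleGraph ι} (lab : ι → Literal)
    (hlab : ∀ i j, G.Adj i j → Compat M (lab i) (lab j)) :
    (fun i => ((form M (lab i) (0, true) : ℤ) : ℝ) / M 0 0) ∈ NPlus G.estab := by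
  have hN : (0 : ℝ) < M 0 0 := by exact_mod_cast hM.pos
  have hle (p r : Literal) : form M p r ≤ form M (0, true) r := by
    have := form_add_form_neg M p r
    have := hM.nonneg p.neg r
    omega
  -- the node `none` carries the literal of `e₀`
  let L : Option ι → Literal := fun a => a.elim (0, true) lab
  have hcone (r : Literal) :
      (fun a => ((form M (L a) r : ℤ) : ℝ) / M 0 0) ∈ homCone G.estab := by
    refine mem_homCone_estab (fun i => ?_) (fun i => ?_) ?_ fun i j hij => ?_
    · exact div_nonneg (by exact_mod_cast hM.nonneg _ _) hN.le
    · gcongr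
      exact hle _ _
    · exact div_nonneg (by exact_mod_cast hM.nonneg _ _) hN.le
    · rw [← add_div]
      gcongr
      exact_mod_cast hlab i j hij r
  refine ⟨fun i => ⟨div_nonneg (by exact_mod_cast hM.nonneg _ _) hN.le, ?_⟩, ?_⟩
  · rw [div_le_one hN]
    exact_mod_cast hle (lab i) (0, true)
  refine ⟨Matrix.of fun a b => ((form M (L a) (L b) : ℤ) : ℝ) / M 0 0,
    ⟨?_, fun a => ?_, fun i => ?_⟩, ?_, fun i => rfl⟩
  · let A : Matrix (Option ι) (Fin 7) ℝ := Matrix.of fun a => (L a).vec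
    have h := (hM.posSemidef.mul_mul_conjTranspose_same A).smul (inv_nonneg.2 hN.le)
    convert h using 1
    ext a b
    have hrow (i : Fin 7) : (M.map (Int.cast : ℤ → ℝ)) i ⬝ᵥ (L b).vec
        = (L b).val ((M.map (Int.cast : ℤ → ℝ)) i) := by
      rw [dotProduct_comm, vec_dotProduct]
    have hab : (A * M.map (Int.cast : ℤ → ℝ) * Aᴴ) a b = form M (L a) (L b) := by
      rw [Matrix.mul_assoc, ← form_map_cast, form, ← vec_dotProduct]
      simp only [← hrow]
      rfl
    rw [Matrix.smul_apply, hab, Matrix.of_apply, smul_eq_mul, div_eq_inv_mul]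
  · simp only [Matrix.of_apply]
    rw [← hM.diag]
    rfl
  · refine ⟨hcone _, ?_⟩
    convert hcone (lab i).neg using 2 with a
    rw [form_neg_right]
    simp only [Matrix.of_apply, L, Option.elim]
    push_cast
    ring
  · exact div_self hN.ne'

/-! ### Two gadgets -/

/-- A gadget for the theta graph with paths of lengths `1, 1, 4`. Its parallel edges are the
coordinates `1, 2` and the path of length four consists of `3, 4, 5, 6`. The
coordinates add up to `134 / 66 > 2`, whereas a matching has at most two edges. -/
def gadgetDouble : Matrix (Fin 7) (Fin 7) ℤ :=
  !![66, 8, 8, 37, 22, 22, 37;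
     8, 8, 0, 0, 4, 4, 0;
     8, 0, 8, 0, 4, 4, 0;
     37, 0, 0, 37, 0, 18, 19;
     22, 4, 4, 0, 22, 0, 18;
     22, 4, 4, 18, 0, 22, 0;
     37, 0, 0, 19, 18, 0, 37]

/-- A gadget for the theta graph with paths of lengths `3, 1, 2`. The paths consist of the
coordinates `1, 2, 3`, the coordinate `4`, and the coordinates `5, 6`, where `1`, `4`, `5` meet at
one end and `3`, `4`, `6` at the other. The coordinates add up to `167 / 83 > 2`, whereas a matching
has at most two edges. -/
def gadgetChord : Matrix (Fin 7) (Fin 7) ℤ :=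
  !![83, 30, 38, 30, 9, 30, 30;
     30, 30, 0, 16, 0, 0, 14;
     38, 0, 38, 0, 9, 16, 16;
     30, 16, 0, 30, 0, 14, 0;
     9, 0, 9, 0, 9, 0, 0;
     30, 0, 16, 14, 0, 30, 0;
     30, 14, 16, 0, 0, 0, 30]

lemma isGadget_gadgetDouble : IsGadget gadgetDouble where
  pos := by decide
  posSemidef := by
    refine .of_dotProduct_mulVec_nonneg ?_ fun x => ?_
    · rw [Matrix.isHermitian_iff_isSymm]
      exact Matrix.IsSymm.map (by decide : gadgetDouble.IsSymm) _
    · -- the form splits along the symmetries `1 ↔ 2` and `3, 4 ↔ 6, 5` of the matrix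
      have h : star x ⬝ᵥ ((gadgetDouble.map (Int.cast : ℤ → ℝ)) *ᵥ x) =
          (66 * x 0 + 8 * (x 1 + x 2) + 37 * (x 3 + x 6) + 22 * (x 4 + x 5)) ^ 2 / 66
          + (25 * (x 1 + x 2) - 37 * (x 3 + x 6) + 11 * (x 4 + x 5)) ^ 2 * (8 / 1650)
          + (31 * (x 3 + x 6) - 68 * (x 4 + x 5)) ^ 2 / 1550
          + (x 4 + x 5) ^ 2 * (3 / 31)
          + 4 * (x 1 - x 2) ^ 2 + 9 * (x 3 - x 6 - x 4 + x 5) ^ 2 + 2 * (x 4 - x 5) ^ 2 := by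
        simp [Matrix.mulVec, dotProduct, Fin.sum_univ_succ, gadgetDouble]
        ring
      rw [h]
      positivity
  nonneg := by decide +kernel
  diag := by decide +kernel

lemma isGadget_gadgetChord : IsGadget gadgetChord where
  pos := by decide
  posSemidef := by
    refine .of_dotProduct_mulVec_nonneg ?_ fun x => ?_
    · rw [Matrix.isHermitian_iff_isSymm]
      exact Matrix.IsSymm.map (by decide : gadgetChord.IsSymm) _
    · -- the form splits along the symmetry `1, 5 ↔ 3, 6` of the matrix
      have h : star x ⬝ᵥ ((gadgetChord.map (Int.cast : ℤ → ℝ)) *ᵥ x) =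
          (83 * x 0 + 30 * (x 1 + x 3) + 38 * x 2 + 9 * x 4 + 30 * (x 5 + x 6)) ^ 2 / 83
          + (1140 * (x 1 + x 3) - 1710 * x 2 - 405 * x 4 - 188 * (x 5 + x 6)) ^ 2 / 141930
          + (9 * (x 1 + x 3) - 7 * (x 5 + x 6)) ^ 2 / 27
          + (29 * x 4 - 16 * (x 5 + x 6)) ^ 2 * (9 / 1102)
          + (x 5 + x 6) ^ 2 * (8 / 3915)
          + 7 * (x 1 - x 3 - x 5 + x 6) ^ 2 + 8 * (x 5 - x 6) ^ 2 := by
        simp [Matrix.mulVec, dotProduct, Fin.sum_univ_succ, gadgetChord]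
        ring
      rw [h]
      positivity
  nonneg := by decide +kernel
  diag := by decide +kernel

/-! ### Theta graphs -/

/-- `H` is the theta graph consisting of the cycle with nodes `v 0, …, v (n - 1)` and edges
`e 0, …, e (n - 1)`, and of a path with edges `f 0, …, f (l - 1)` from `v 0` to `v m` whose inner
nodes `p 1, …, p (l - 1)` are not on the cycle. Sequences are indexed by `ℕ`, and their values
beyond the stated ranges are irrelevant. -/
structure Graph.IsTheta {α β : Type*} (H : Graph α β) (n m l : ℕ) (v p : ℕ → α)
    (e f : ℕ → E(H)) : Prop where
  m_pos : 0 < m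
  m_lt : m < n
  l_pos : 0 < l
  link_e : ∀ i < n, H.IsLink (e i) (v i) (v (i + 1))
  v_last : v n = v 0
  v_inj : ∀ i < n, ∀ j < n, v i = v j → i = j
  link_f : ∀ j < l, H.IsLink (f j) (p j) (p (j + 1))
  p_zero : p 0 = v 0
  p_last : p l = v m
  p_inj : ∀ i ≤ l, ∀ j ≤ l, p i = p j → i = j
  v_ne_p : ∀ i < n, ∀ j, 0 < j → j < l → v i ≠ p j
  e_inj : ∀ i < n, ∀ j < n, e i = e j → i = j
  f_inj : ∀ i < l, ∀ j < l, f i = f j → i = j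
  e_ne_f : ∀ i < n, ∀ j < l, e i ≠ f j
  surj : ∀ x, (∃ i < n, e i = x) ∨ ∃ j < l, f j = x

namespace Graph.IsTheta

variable {α β : Type*} {H : Graph α β} {n m l : ℕ} {v p : ℕ → α} {e f : ℕ → E(H)}

lemma finite_edgeSet (h : H.IsTheta n m l v p e f) : Finite E(H) := by
  refine Set.finite_univ_iff.1
    ((((Set.finite_Iio n).image e).union ((Set.finite_Iio l).image f)).subset fun x _ => ?_)
  rcases h.surj x with ⟨i, hi, rfl⟩ | ⟨j, hj, rfl⟩
  · exact Or.inl ⟨i, hi, rfl⟩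
  · exact Or.inr ⟨j, hj, rfl⟩

lemma v_eq (h : H.IsTheta n m l v p e f) {i j : ℕ} (hi : i ≤ n) (hj : j ≤ n) (hij : v i = v j) :
    i = j ∨ (i = 0 ∧ j = n) ∨ (i = n ∧ j = 0) := by
  have hn : 0 < n := h.m_pos.trans h.m_lt
  rcases hi.lt_or_eq with hi | rfl <;> rcases hj.lt_or_eq with hj | rfl
  · exact Or.inl (h.v_inj i hi j hj hij)
  · rw [h.v_last] at hij
    exact Or.inr (Or.inl ⟨h.v_inj i hi 0 hn hij, rfl⟩)
  · rw [h.v_last] at hij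
    exact Or.inr (Or.inr ⟨rfl, (h.v_inj 0 hn j hj hij).symm⟩)
  · exact Or.inl rfl

lemma v_eq_p (h : H.IsTheta n m l v p e f) {i j : ℕ} (hi : i ≤ n) (hj : j ≤ l)
    (hij : v i = p j) : (j = 0 ∧ (i = 0 ∨ i = n)) ∨ (j = l ∧ i = m) := by
  have hm := h.m_pos
  have hmn := h.m_lt
  rcases j.eq_zero_or_pos with rfl | hj0
  · rw [h.p_zero] at hij
    have := h.v_eq hi (Nat.zero_le _) hij
    omega
  rcases hj.lt_or_eq with hj | rfl
  · rcases hi.lt_or_eq with hi | rfl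
    · exact absurd hij (h.v_ne_p i hi j hj0 hj)
    · rw [h.v_last] at hij
      exact absurd hij (h.v_ne_p 0 (by omega) j hj0 hj)
  · rw [h.p_last] at hij
    have := h.v_eq hi hmn.le hij
    omega

lemma exists_eq_of_inc_e (h : H.IsTheta n m l v p e f) {i : ℕ} (hi : i < n) {w : α}
    (hw : H.Inc (e i) w) : ∃ i', (i' = i ∨ i' = i + 1) ∧ w = v i' := by
  rcases hw.eq_or_eq_of_isLink (h.link_e i hi) with rfl | rfl
  · exact ⟨i, Or.inl rfl, rfl⟩
  · exact ⟨i + 1, Or.inr rfl, rfl⟩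

lemma exists_eq_of_inc_f (h : H.IsTheta n m l v p e f) {j : ℕ} (hj : j < l) {w : α}
    (hw : H.Inc (f j) w) : ∃ j', (j' = j ∨ j' = j + 1) ∧ w = p j' := by
  rcases hw.eq_or_eq_of_isLink (h.link_f j hj) with rfl | rfl
  · exact ⟨j, Or.inl rfl, rfl⟩
  · exact ⟨j + 1, Or.inr rfl, rfl⟩

lemma adj_e_e (h : H.IsTheta n m l v p e f) {i j : ℕ} (hi : i < n) (hj : j < n)
    (hij : H.lineGraph.Adj (e i) (e j)) :
    j = i + 1 ∨ i = j + 1 ∨ (i = 0 ∧ j = n - 1) ∨ (i = n - 1 ∧ j = 0) := by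
  obtain ⟨hne, w, hwi, hwj⟩ := hij
  have hne' : i ≠ j := by rintro rfl; exact hne rfl
  obtain ⟨i', hi', rfl⟩ := h.exists_eq_of_inc_e hi hwi
  obtain ⟨j', hj', hv⟩ := h.exists_eq_of_inc_e hj hwj
  have := h.v_eq (by omega) (by omega) hv
  omega

lemma adj_f_f (h : H.IsTheta n m l v p e f) {i j : ℕ} (hi : i < l) (hj : j < l)
    (hij : H.lineGraph.Adj (f i) (f j)) : j = i + 1 ∨ i = j + 1 := by
  obtain ⟨hne, w, hwi, hwj⟩ := hij
  have hne' : i ≠ j := by rintro rfl; exact hne rfl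
  obtain ⟨i', hi', rfl⟩ := h.exists_eq_of_inc_f hi hwi
  obtain ⟨j', hj', hv⟩ := h.exists_eq_of_inc_f hj hwj
  have := h.p_inj _ (by omega) _ (by omega) hv
  omega

lemma adj_e_f (h : H.IsTheta n m l v p e f) {i j : ℕ} (hi : i < n) (hj : j < l)
    (hij : H.lineGraph.Adj (e i) (f j)) :
    (j = 0 ∧ (i = 0 ∨ i = n - 1)) ∨ (j = l - 1 ∧ (i = m - 1 ∨ i = m)) := by
  obtain ⟨hne, w, hwi, hwj⟩ := hij
  obtain ⟨i', hi', rfl⟩ := h.exists_eq_of_inc_e hi hwi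
  obtain ⟨j', hj', hv⟩ := h.exists_eq_of_inc_f hj hwj
  have := h.v_eq_p (by omega) (by omega) hv
  omega

lemma indicator_add_le_one {P Q : Prop} [Decidable P] [Decidable Q] (h : P → Q → False) :
    (if P then 1 else 0) + (if Q then 1 else 0) ≤ 1 := by
  by_cases hP : P
  · rw [if_pos hP, if_neg (h hP)]
  · rw [if_neg hP, zero_add]
    split_ifs <;> simp

lemma indicator_add_add_le_one {P Q R : Prop} [Decidable P] [Decidable Q] [Decidable R]
    (hPQ : P → Q → False) (hPR : P → R → False) (hQR : Q → R → False) :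
    (if P then 1 else 0) + (if Q then 1 else 0) + (if R then 1 else 0) ≤ 1 := by
  by_cases hP : P
  · rw [if_pos hP, if_neg (hPQ hP), if_neg (hPR hP)]
  · rw [if_neg hP, zero_add]
    exact indicator_add_le_one hQR

/-- A stable set of the line graph is a matching. If the theta graph has an odd number
`2 k + 2 r + 1` of nodes, then counting the nodes covered by the matching bounds its size. -/
lemma sum_le_of_isIndepSet {k r : ℕ} (h : H.IsTheta (2 * k + 1) m (2 * r + 1) v p e f)
    {S : Set E(H)} (hS : H.lineGraph.IsIndepSet S) [DecidablePred (· ∈ S)] :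
    ∑ i ∈ Finset.range (2 * k + 1), (if e i ∈ S then 1 else 0)
      + ∑ j ∈ Finset.range (2 * r + 1), (if f j ∈ S then 1 else 0) ≤ k + r := by
  have hm := h.m_pos
  have hmn := h.m_lt
  have key {a b : E(H)} (w : α) (ha : H.Inc a w) (hb : H.Inc b w) (hab : a ≠ b) (haS : a ∈ S)
      (hbS : b ∈ S) : False := hS haS hbS hab ⟨hab, w, ha, hb⟩
  have incl {i : ℕ} (hi : i < 2 * k + 1) : H.Inc (e i) (v i) := (h.link_e i hi).inc_left
  have incr {i : ℕ} (hi : i < 2 * k + 1) : H.Inc (e i) (v (i + 1)) := (h.link_e i hi).inc_right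
  have ee {i j : ℕ} (hi : i < 2 * k + 1) (hj : j < 2 * k + 1) (hij : i ≠ j) : e i ≠ e j :=
    fun h' => hij (h.e_inj i hi j hj h')
  set s : ℕ → ℕ := fun i => if e i ∈ S then 1 else 0
  set t : ℕ → ℕ := fun j => if f j ∈ S then 1 else 0
  have flast : H.Inc (f (2 * r)) (v m) := by
    rw [← h.p_last]
    exact (h.link_f (2 * r) (by omega)).inc_right
  have ffirst : H.Inc (f 0) (v 0) := by
    rw [← h.p_zero]
    exact (h.link_f 0 (by omega)).inc_left
  have elast : H.Inc (e (2 * k)) (v 0) := by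
    rw [← h.v_last]
    exact incr (by omega)
  -- the constraint at the node `v (i + 1)`
  have h1 : ∀ i ∈ Finset.range (2 * k),
      s i + s (i + 1) + (if i = m - 1 then t (2 * r) else 0) ≤ 1 := by
    intro i hi
    rw [Finset.mem_range] at hi
    have a1 := key (v (i + 1)) (incr (by omega)) (incl (by omega))
      (ee (i := i) (j := i + 1) (by omega) (by omega) (by omega))
    by_cases him : i = m - 1
    · have him' : i + 1 = m := by omega
      have a2 := key (v m) (him' ▸ incr (by omega)) flast (h.e_ne_f i (by omega) _ (by omega))
      have a3 := key (v m) (him' ▸ incl (by omega)) flast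
        (h.e_ne_f (i + 1) (by omega) _ (by omega))
      rw [if_pos him]
      exact indicator_add_add_le_one a1 a2 a3
    · rw [if_neg him, add_zero]
      exact indicator_add_le_one a1
  -- the constraint at the node `v 0`
  have h2 : s (2 * k) + s 0 + t 0 ≤ 1 := by
    have a1 := key (v 0) elast (incl (by omega))
      (ee (i := 2 * k) (j := 0) (by omega) (by omega) (by omega))
    have a2 := key (v 0) elast ffirst (h.e_ne_f _ (by omega) _ (by omega))
    have a3 := key (v 0) (incl (by omega)) ffirst (h.e_ne_f 0 (by omega) _ (by omega))
    exact indicator_add_add_le_one a1 a2 a3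
  -- the constraint at the node `p (j + 1)`
  have h3 : ∀ j ∈ Finset.range (2 * r), t j + t (j + 1) ≤ 1 := by
    intro j hj
    rw [Finset.mem_range] at hj
    have a1 := key (p (j + 1)) (h.link_f j (by omega)).inc_right
      (h.link_f (j + 1) (by omega)).inc_left
      fun h' => by have := h.f_inj j (by omega) (j + 1) (by omega) h'; omega
    exact indicator_add_le_one a1
  have H1 := Finset.sum_le_sum h1
  have H3 := Finset.sum_le_sum h3
  have hmem : m - 1 ∈ Finset.range (2 * k) := Finset.mem_range.2 (by omega)
  rw [Finset.sum_add_distrib, Finset.sum_add_distrib, Finset.sum_ite_eq' , if_pos hmem] at H1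
  rw [Finset.sum_add_distrib] at H3
  simp only [Finset.sum_const, Finset.card_range, smul_eq_mul, mul_one] at H1 H3
  have e1 : ∑ i ∈ Finset.range (2 * k + 1), s i = _ := Finset.sum_range_succ s (2 * k)
  have e2 : ∑ i ∈ Finset.range (2 * k + 1), s i = _ := Finset.sum_range_succ' s (2 * k)
  have e3 : ∑ j ∈ Finset.range (2 * r + 1), t j = _ := Finset.sum_range_succ t (2 * r)
  have e4 : ∑ j ∈ Finset.range (2 * r + 1), t j = _ := Finset.sum_range_succ' t (2 * r)
  change ∑ i ∈ Finset.range (2 * k + 1), s i + ∑ j ∈ Finset.range (2 * r + 1), t j ≤ k + r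
  omega

lemma sum_le_of_mem_stab {k r : ℕ} (h : H.IsTheta (2 * k + 1) m (2 * r + 1) v p e f)
    {x : E(H) → ℝ} (hx : x ∈ H.lineGraph.stab) :
    ∑ i ∈ Finset.range (2 * k + 1), x (e i) + ∑ j ∈ Finset.range (2 * r + 1), x (f j)
      ≤ k + r := by
  classical
  have hlin : IsLinearMap ℝ fun x : E(H) → ℝ =>
      ∑ i ∈ Finset.range (2 * k + 1), x (e i) + ∑ j ∈ Finset.range (2 * r + 1), x (f j) :=
    { map_add := fun x y => by simp only [Pi.add_apply, Finset.sum_add_distrib]; ring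
      map_smul := fun c x => by
        simp only [Pi.smul_apply, smul_eq_mul, ← Finset.mul_sum, mul_add] }
  refine convexHull_min ?_ (convex_halfSpace_le hlin ((k : ℝ) + r)) hx
  rintro _ ⟨S, hS, rfl⟩
  have := h.sum_le_of_isIndepSet hS
  simp only [Set.mem_ofPred_eq, Set.indicator_apply, Pi.one_apply]
  exact_mod_cast this

lemma exists_labelling (h : H.IsTheta n m l v p e f) {T : Type*} (A B : ℕ → T) :
    ∃ lab : E(H) → T, (∀ i < n, lab (e i) = A i) ∧ ∀ j < l, lab (f j) = B j := by
  have (x : E(H)) : ∃ q : T, (∀ i < n, e i = x → q = A i) ∧ ∀ j < l, f j = x → q = B j := by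
    rcases h.surj x with ⟨i, hi, rfl⟩ | ⟨j, hj, rfl⟩
    · exact ⟨A i, fun i' hi' hii => by rw [h.e_inj _ hi' _ hi hii],
        fun j hj hij => absurd hij.symm (h.e_ne_f i hi j hj)⟩
    · exact ⟨B j, fun i hi hij => absurd hij (h.e_ne_f i hi j hj),
        fun j' hj' hjj => by rw [h.f_inj _ hj' _ hj hjj]⟩
  choose lab h1 h2 using this
  exact ⟨lab, fun i hi => h1 _ i hi rfl, fun j hj => h2 _ j hj rfl⟩

/-- Labelling the edges of an odd theta graph by pairwise compatible literals of a gadget gives a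
point of `N₊(ESTAB)`. If its coordinates add up to more than the size of a maximum matching, then
the line graph is `N₊`-imperfect. -/
theorem isNPlusImperfect_of_labelling {k r : ℕ}
    (h : H.IsTheta (2 * k + 1) m (2 * r + 1) v p e f)
    {M : Matrix (Fin 7) (Fin 7) ℤ} (hM : IsGadget M) (A B : ℕ → Literal)
    (hA : ∀ i < 2 * k, Compat M (A i) (A (i + 1))) (hA0 : Compat M (A (2 * k)) (A 0))
    (hB : ∀ j < 2 * r, Compat M (B j) (B (j + 1)))
    (h00 : Compat M (A 0) (B 0)) (h10 : Compat M (A (2 * k)) (B 0))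
    (h01 : Compat M (A (m - 1)) (B (2 * r))) (h11 : Compat M (A m) (B (2 * r)))
    (hsum : M 0 0 * (k + r) < ∑ i ∈ Finset.range (2 * k + 1), form M (A i) (0, true)
      + ∑ j ∈ Finset.range (2 * r + 1), form M (B j) (0, true)) :
    H.lineGraph.IsNPlusImperfect := by
  intro hperf
  have := h.finite_edgeSet
  obtain ⟨lab, hlA, hlB⟩ := h.exists_labelling A B
  have hAB {i j : ℕ} (hi : i < 2 * k + 1) (hj : j < 2 * r + 1)
      (hij : H.lineGraph.Adj (e i) (f j)) : Compat M (A i) (B j) := by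
    rcases h.adj_e_f hi hj hij with ⟨rfl, rfl | rfl⟩ | ⟨rfl, rfl | rfl⟩
    exacts [h00, h10, h01, h11]
  have hmem := hM.mem_nPlus_estab (G := H.lineGraph) lab fun x y hxy => by
    rcases h.surj x with ⟨i, hi, rfl⟩ | ⟨i, hi, rfl⟩ <;>
      rcases h.surj y with ⟨j, hj, rfl⟩ | ⟨j, hj, rfl⟩
    · rw [hlA i hi, hlA j hj]
      rcases h.adj_e_e hi hj hxy with rfl | rfl | ⟨rfl, rfl⟩ | ⟨rfl, rfl⟩
      exacts [hA i (by omega), (hA j (by omega)).symm, hA0.symm, hA0]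
    · rw [hlA i hi, hlB j hj]
      exact hAB hi hj hxy
    · rw [hlB i hi, hlA j hj]
      exact (hAB hj hi hxy.symm).symm
    · rw [hlB i hi, hlB j hj]
      rcases h.adj_f_f hi hj hxy with rfl | rfl
      exacts [hB i (by omega), (hB j (by omega)).symm]
  rw [hperf] at hmem
  have hle := h.sum_le_of_mem_stab hmem
  have hN : (0 : ℝ) < M 0 0 := by exact_mod_cast hM.pos
  rw [← Finset.sum_div, ← Finset.sum_div, ← add_div, div_le_iff₀' hN,
    Finset.sum_congr rfl fun i hi => by rw [hlA i (Finset.mem_range.1 hi)],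
    Finset.sum_congr (s₁ := Finset.range (2 * r + 1)) rfl
      fun j hj => by rw [hlB j (Finset.mem_range.1 hj)]] at hle
  exact absurd hsum (not_lt.2 (by exact_mod_cast hle))

end Graph.IsTheta

/-! ### Alternating labellings -/

namespace Literal

/-- The sequence `p, ¬p, p, ¬p, …` of literals. -/
def alt (p : Literal) (i : ℕ) : Literal := if Even i then p else p.neg

lemma alt_two_mul (p : Literal) (i : ℕ) : alt p (2 * i) = p := if_pos (even_two_mul i)

lemma alt_two_mul_add_one (p : Literal) (i : ℕ) : alt p (2 * i + 1) = p.neg :=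
  if_neg (by simp)

lemma compat_alt (M : Matrix (Fin 7) (Fin 7) ℤ) (p : Literal) (i : ℕ) :
    Compat M (alt p i) (alt p (i + 1)) := by
  rcases i.even_or_odd' with ⟨c, rfl | rfl⟩
  · rw [alt_two_mul, alt_two_mul_add_one]
    exact compat_neg M p
  · rw [alt_two_mul_add_one, show 2 * c + 1 + 1 = 2 * (c + 1) by ring, alt_two_mul]
    exact (compat_neg M p).symm

lemma sum_alt (M : Matrix (Fin 7) (Fin 7) ℤ) (p : Literal) (r : ℕ) :
    ∑ i ∈ Finset.range (2 * r + 1), form M (alt p i) (0, true)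
      = form M p (0, true) + r * M 0 0 := by
  induction r with
  | zero => simp [alt]
  | succ r ih =>
    rw [show 2 * (r + 1) + 1 = 2 * r + 1 + 1 + 1 by ring, Finset.sum_range_succ,
      Finset.sum_range_succ, ih, alt_two_mul_add_one, show 2 * r + 1 + 1 = 2 * (r + 1) by ring,
      alt_two_mul]
    have h := form_add_form_neg M p (0, true)
    have h0 : form M (0, true) (0, true) = M 0 0 := rfl
    push_cast
    linarith

end Literal

namespace Graph.IsTheta

variable {α β : Type*} {H : Graph α β} {v p : ℕ → α} {e f : ℕ → E(H)}

/-- The labels on the cycle of a theta graph with paths of lengths `1`, `2 r + 1`, `2 k`, where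
`k ≥ 2`. The surplus edges of the even path repeat the label of its last edge alternatingly. -/
def doubleLabel : ℕ → Literal
  | 0 => (1, true)
  | 1 => (3, true)
  | 2 => (4, true)
  | 3 => (5, true)
  | i + 4 => alt (6, true) i

/-- The line graph of a theta graph with path lengths `1`, `2 r + 1` and `2 k + 4`. -/
theorem isNPlusImperfect_of_one {k r : ℕ}
    (h : H.IsTheta (2 * (k + 2) + 1) 1 (2 * r + 1) v p e f) :
    H.lineGraph.IsNPlusImperfect := by
  have hlast : doubleLabel (2 * (k + 2)) = (6, true) := alt_two_mul _ k
  refine h.isNPlusImperfect_of_labelling isGadget_gadgetDouble doubleLabel (alt (2, true))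
    (fun i _ => ?_) ?_ (fun j _ => compat_alt _ _ j) ?_ ?_ ?_ ?_ ?_
  · match i with
    | 0 => decide +kernel
    | 1 => decide +kernel
    | 2 => decide +kernel
    | 3 => decide +kernel
    | i + 4 => exact compat_alt _ _ i
  · rw [hlast]; decide +kernel
  · decide +kernel
  · rw [hlast]; decide +kernel
  · rw [alt_two_mul]; decide +kernel
  · rw [alt_two_mul]; decide +kernel
  · rw [sum_alt, show 2 * (k + 2) + 1 = 2 * k + 1 + 1 + 1 + 1 + 1 by ring]
    simp only [Finset.sum_range_succ' _ (2 * k + 1 + 1 + 1 + 1),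
      Finset.sum_range_succ' _ (2 * k + 1 + 1 + 1), Finset.sum_range_succ' _ (2 * k + 1 + 1),
      Finset.sum_range_succ' _ (2 * k + 1), doubleLabel, sum_alt]
    have h00 : gadgetDouble 0 0 = 66 := rfl
    have h1 : form gadgetDouble (1, true) (0, true) = 8 := rfl
    have h2 : form gadgetDouble (2, true) (0, true) = 8 := rfl
    have h3 : form gadgetDouble (3, true) (0, true) = 37 := rfl
    have h4 : form gadgetDouble (4, true) (0, true) = 22 := rfl
    have h5 : form gadgetDouble (5, true) (0, true) = 22 := rfl
    have h6 : form gadgetDouble (6, true) (0, true) = 37 := rfl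
    simp only [h00, h1, h2, h3, h4, h5, h6]
    push_cast
    linarith

/-- The labels on a path of odd length at least three, obtained by subdividing the edge `3` of
the path `1, 2, 3`. -/
def chordLabelOdd : ℕ → Literal
  | 0 => (1, true)
  | 1 => (2, true)
  | i + 2 => alt (3, true) i

/-- The labels on a path of even length at least two, obtained by subdividing the edge `5` of
the path `6, 5`. -/
def chordLabelEven : ℕ → Literal
  | 0 => (6, true)
  | i + 1 => alt (5, true) i

/-- The labels on the cycle of a theta graph with paths of lengths `m`, `2 r + 1` and `2 b`, where
`m ≥ 3` is odd and `b ≥ 1`. -/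
def chordLabel (m i : ℕ) : Literal :=
  if i < m then chordLabelOdd i else chordLabelEven (i - m)

/-- The line graph of a theta graph with path lengths `2 a + 3`, `2 r + 1` and `2 b + 2`. -/
theorem isNPlusImperfect_of_three_le {a b r : ℕ}
    (h : H.IsTheta (2 * (a + b + 2) + 1) (2 * a + 3) (2 * r + 1) v p e f) :
    H.lineGraph.IsNPlusImperfect := by
  have hlt {i : ℕ} (hi : i < 2 * a + 3) : chordLabel (2 * a + 3) i = chordLabelOdd i :=
    if_pos hi
  have hge (i : ℕ) : chordLabel (2 * a + 3) (2 * a + 3 + i) = chordLabelEven i := by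
    rw [chordLabel, if_neg (by omega), Nat.add_sub_cancel_left]
  have hmid : chordLabel (2 * a + 3) (2 * a + 3) = (6, true) := hge 0
  have hend : chordLabelOdd (2 * a + 2) = (3, true) := alt_two_mul _ a
  have hlast : chordLabel (2 * a + 3) (2 * (a + b + 2)) = (5, true) := by
    rw [show 2 * (a + b + 2) = 2 * a + 3 + (2 * b + 1) by ring, hge]
    exact alt_two_mul _ b
  refine h.isNPlusImperfect_of_labelling isGadget_gadgetChord (chordLabel (2 * a + 3))
    (alt (4, true)) (fun i hi => ?_) ?_ (fun j _ => compat_alt _ _ j) ?_ ?_ ?_ ?_ ?_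
  · rcases lt_trichotomy (i + 1) (2 * a + 3) with hi' | hi' | hi'
    · rw [hlt (by omega), hlt hi']
      match i with
      | 0 => decide +kernel
      | 1 => decide +kernel
      | i + 2 => exact compat_alt _ _ i
    · rw [hlt (by omega), hi', hmid, show i = 2 * a + 2 by omega, hend]
      decide +kernel
    · obtain ⟨j, rfl⟩ := Nat.exists_eq_add_of_le (show 2 * a + 3 ≤ i by omega)
      rw [add_assoc _ j 1, hge, hge]
      match j with
      | 0 => decide +kernel
      | j + 1 => exact compat_alt _ _ j
  · rw [hlast, hlt (by omega)]; decide +kernel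
  · rw [hlt (by omega)]; decide +kernel
  · rw [hlast]; decide +kernel
  · rw [alt_two_mul, hlt (by omega), Nat.add_sub_cancel (m := 1), hend]; decide +kernel
  · rw [alt_two_mul, hmid]; decide +kernel
  · rw [sum_alt, show 2 * (a + b + 2) + 1 = 2 * a + 3 + (2 * b + 1 + 1) by ring,
      Finset.sum_range_add, Finset.sum_congr rfl fun i hi => by rw [hlt (Finset.mem_range.1 hi)]]
    simp only [hge, Finset.sum_range_succ' _ (2 * a + 1 + 1),
      Finset.sum_range_succ' _ (2 * a + 1), Finset.sum_range_succ' _ (2 * b + 1),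
      show 2 * a + 3 = 2 * a + 1 + 1 + 1 by ring, chordLabelOdd, chordLabelEven, sum_alt]
    have h00 : gadgetChord 0 0 = 83 := rfl
    have h1 : form gadgetChord (1, true) (0, true) = 30 := rfl
    have h2 : form gadgetChord (2, true) (0, true) = 38 := rfl
    have h3 : form gadgetChord (3, true) (0, true) = 30 := rfl
    have h4 : form gadgetChord (4, true) (0, true) = 9 := rfl
    have h5 : form gadgetChord (5, true) (0, true) = 30 := rfl
    have h6 : form gadgetChord (6, true) (0, true) = 30 := rfl
    simp only [h00, h1, h2, h3, h4, h5, h6]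
    push_cast
    linarith

end Graph.IsTheta

/-! ### The three families consist of theta graphs -/

namespace Graph

variable {α β : Type*} {C H : Graph α β} {x y : α}

/-- The odd hole `C` is traversed from `x` through `v 0 = x, v 1, …`, and it reaches `y` after an
odd number `m` of steps. -/
structure IsOddHole.IsTraversal (C : Graph α β) (x y : α) (k m : ℕ) (v : ℕ → α) (e : ℕ → β) :
    Prop where
  odd : Odd m
  m_lt : m < 2 * k + 1
  link : ∀ i, C.IsLink (e i) (v i) (v (i + 1))
  v_zero : v 0 = x
  v_m : v m = y
  v_last : v (2 * k + 1) = v 0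
  v_inj : ∀ i < 2 * k + 1, ∀ j < 2 * k + 1, v i = v j → i = j
  e_inj : ∀ i < 2 * k + 1, ∀ j < 2 * k + 1, e i = e j → i = j
  v_mem : ∀ i, v i ∈ V(C)
  surj : ∀ b ∈ E(C), ∃ i < 2 * k + 1, e i = b
  adj_iff : C.Adj x y ↔ m = 1

/-- Of the two arcs between two nodes of an odd hole one is odd, so that one of the two
directions gives a traversal. -/
lemma IsOddHole.exists_isTraversal (hC : C.IsOddHole) (hx : x ∈ V(C)) (hy : y ∈ V(C))
    (hxy : x ≠ y) : ∃ k ≥ 2, ∃ m v e, IsOddHole.IsTraversal C x y k m v e := by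
  obtain ⟨k, hk, w, e, hw, he, hV, hE, hlink⟩ := hC
  rw [hV] at hx hy
  obtain ⟨a, rfl⟩ := hx
  obtain ⟨b, rfl⟩ := hy
  refine ⟨k, hk, ?_⟩
  have cast_inj {i j : ℕ} (hi : i < 2 * k + 1) (hj : j < 2 * k + 1)
      (hij : (i : ZMod (2 * k + 1)) = j) : i = j := by
    rw [ZMod.natCast_eq_natCast_iff', Nat.mod_eq_of_lt hi, Nat.mod_eq_of_lt hj] at hij
    exact hij
  have main (w : ZMod (2 * k + 1) → α) (e : ZMod (2 * k + 1) → β) (hw : Function.Injective w)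
      (he : Function.Injective e) (hV : V(C) = Set.range w) (hE : E(C) = Set.range e)
      (hlink : ∀ i, C.IsLink (e i) (w i) (w (i + 1))) (a b : ZMod (2 * k + 1))
      (hodd : Odd (b - a).val) :
      ∃ m v e, IsOddHole.IsTraversal C (w a) (w b) k m v e := by
    have hcast : ((b - a).val : ZMod (2 * k + 1)) = b - a := ZMod.natCast_zmod_val _
    have hlt := ZMod.val_lt (b - a)
    refine ⟨(b - a).val, fun i => w (a + i), fun i => e (a + i), hodd, hlt, fun i => ?_, by simp,
      by simp, ?_, fun i hi j hj hij => cast_inj hi hj (add_left_cancel (hw hij)),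
      fun i hi j hj hij => cast_inj hi hj (add_left_cancel (he hij)),
      fun i => hV ▸ Set.mem_range_self _, fun d hd => ?_, fun hadj => ?_, fun hm => ?_⟩
    · simpa [add_assoc] using hlink (a + i)
    · have := ZMod.natCast_self (2 * k + 1)
      simp only [this, Nat.cast_zero]
    · rw [hE] at hd
      obtain ⟨c, rfl⟩ := hd
      exact ⟨(c - a).val, ZMod.val_lt _, by simp⟩
    · obtain ⟨d, hd⟩ := hadj
      have hdE := hd.edge_mem
      rw [hE] at hdE
      obtain ⟨c, rfl⟩ := hdE
      rcases hd.eq_and_eq_or_eq_and_eq (hlink c) with ⟨h1, h2⟩ | ⟨h1, h2⟩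
      · rw [hw h1, hw h2]
        refine cast_inj (ZMod.val_lt _) (by omega) ?_
        simp
      · -- if `y` came directly before `x`, then the number of steps would be `2 k`
        have h3 : (b - a).val = 2 * k := by
          rw [hw h1, hw h2]
          refine cast_inj (ZMod.val_lt _) (by omega) ?_
          have := ZMod.natCast_self (2 * k + 1)
          push_cast at this
          rw [ZMod.natCast_zmod_val]
          push_cast
          linear_combination -this
        rw [h3] at hodd
        exact absurd hodd (by simp)
    · rw [hm, Nat.cast_one] at hcast
      have := hlink a
      rw [hcast, add_sub_cancel] at this
      exact this.adj
  have hab : b - a ≠ 0 := fun h => hxy (by rw [sub_eq_zero.1 h])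
  rcases (b - a).val.even_or_odd with hev | hodd
  · -- traverse the cycle in the opposite direction
    have h := main (fun i => w (-i)) (fun i => e (-i - 1)) (hw.comp neg_injective)
      (he.comp ((sub_left_injective).comp neg_injective))
      (by rw [hV]; exact ((Equiv.neg _).surjective.range_comp w).symm)
      (by rw [hE]; exact (((Equiv.neg _).trans (Equiv.subRight 1)).surjective.range_comp e).symm)
      (fun i => by simpa [neg_add, sub_eq_add_neg, add_comm] using (hlink (-i - 1)).symm) (-a) (-b)
      (by
        have := ZMod.val_lt (b - a)
        rw [show -b - -a = -(b - a) by ring, ZMod.neg_val, if_neg hab,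
          Nat.odd_sub this.le]
        simp [hev])
    simpa using h
  · exact main w e hw he hV hE hlink a b hodd

namespace IsOddHole.IsTraversal

variable {k m : ℕ} {v : ℕ → α} {e : ℕ → β}

lemma isTheta_of_edge (h : IsOddHole.IsTraversal C x y k m v e) (hCH : C ≤ H) {d : β}
    (hd : d ∉ E(C)) (hdxy : H.IsLink d x y) (hE : E(H) = insert d E(C)) :
    ∃ p e f, H.IsTheta (2 * k + 1) m 1 v p e f := by
  have hm := h.odd.pos
  refine ⟨fun j => if j = 0 then x else y, fun i => ⟨e i, ((h.link i).mono hCH).edge_mem⟩,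
    fun _ => ⟨d, hdxy.edge_mem⟩, hm, h.m_lt, Nat.one_pos, fun i _ => (h.link i).mono hCH,
    h.v_last, h.v_inj, fun j hj => ?_, by simp [h.v_zero], by simp [h.v_m],
    fun i hi j hj hij => ?_, fun i _ j _ _ => by omega,
    fun i hi j hj hij => h.e_inj i hi j hj (congrArg Subtype.val hij), fun i _ j _ _ => by omega,
    fun i _ j _ hij => ?_, fun z => ?_⟩
  · obtain rfl : j = 0 := by omega
    simpa using hdxy
  · have hne : x ≠ y := by
      rw [← h.v_zero, ← h.v_m]
      intro h0
      have := h.v_inj _ (by omega) _ h.m_lt h0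
      omega
    by_contra hc
    rcases Nat.le_one_iff_eq_zero_or_eq_one.1 hi with rfl | rfl <;>
      rcases Nat.le_one_iff_eq_zero_or_eq_one.1 hj with rfl | rfl <;> simp_all
  · have h0 : e i = d := congrArg Subtype.val hij
    exact hd (h0 ▸ (h.link i).edge_mem)
  · rcases hE.subset z.2 with hz | hz
    · exact Or.inr ⟨0, Nat.one_pos, Subtype.ext hz.symm⟩
    · obtain ⟨i, hi, hiz⟩ := h.surj _ hz
      exact Or.inl ⟨i, hi, Subtype.ext hiz⟩

lemma isTheta_of_path (h : IsOddHole.IsTraversal C x y k m v e) (hCH : C ≤ H) {P : Graph α β}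
    (hPH : P ≤ H) {l : ℕ} (hl : 0 < l) (hP : P.IsPathOfLength l x y)
    (hV : V(C) ∩ V(P) = {x, y}) (hdisj : E(C) ∩ E(P) = ∅) (hE : E(H) = E(C) ∪ E(P)) :
    ∃ p e f, H.IsTheta (2 * k + 1) m l v p e f := by
  have hm := h.odd.pos
  obtain ⟨p, f, hp, hf, hVP, hEP, hlink, rfl, rfl⟩ := hP
  have hfmem (j : Fin l) : f j ∈ E(H) := ((hlink j).mono hPH).edge_mem
  refine ⟨fun j => if hj : j < l + 1 then p ⟨j, hj⟩ else p 0,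
    fun i => ⟨e i, ((h.link i).mono hCH).edge_mem⟩,
    fun j => if hj : j < l then ⟨f ⟨j, hj⟩, hfmem _⟩ else ⟨f ⟨0, hl⟩, hfmem _⟩,
    hm, h.m_lt, hl, fun i _ => (h.link i).mono hCH, h.v_last, h.v_inj, fun j hj => ?_, ?_, ?_,
    fun i hi j hj hij => ?_, fun i hi j hj0 hj hij => ?_,
    fun i hi j hj hij => h.e_inj i hi j hj (congrArg Subtype.val hij), fun i hi j hj hij => ?_,
    fun i _ j hj hij => ?_, fun z => ?_⟩
  · rw [dif_pos (by omega : j < l + 1), dif_pos (by omega : j + 1 < l + 1), dif_pos hj]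
    exact (hlink ⟨j, hj⟩).mono hPH
  · rw [dif_pos (by omega), h.v_zero]
    rfl
  · rw [dif_pos (by omega), h.v_m]
    rfl
  · rw [dif_pos (by omega : i < l + 1), dif_pos (by omega : j < l + 1)] at hij
    exact congrArg Fin.val (hp hij)
  · rw [dif_pos (by omega : j < l + 1)] at hij
    have hmem : v i ∈ V(C) ∩ V(P) := ⟨h.v_mem i, by rw [hij, hVP]; exact Set.mem_range_self _⟩
    rw [hV, hij] at hmem
    rcases hmem with h0 | h0
    · have := congrArg Fin.val (hp h0)
      simp at this
      omega
    · have := congrArg Fin.val (hp h0)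
      simp at this
      omega
  · rw [dif_pos hi, dif_pos hj] at hij
    exact congrArg Fin.val (hf (congrArg Subtype.val hij))
  · rw [dif_pos hj] at hij
    have h0 : e i = f ⟨j, hj⟩ := congrArg Subtype.val hij
    have hmem : e i ∈ E(C) ∩ E(P) := ⟨(h.link i).edge_mem, h0 ▸ (hlink _).edge_mem⟩
    rw [hdisj] at hmem
    exact hmem
  · rcases hE.subset z.2 with hz | hz
    · obtain ⟨i, hi, hiz⟩ := h.surj _ hz
      exact Or.inl ⟨i, hi, Subtype.ext hiz⟩
    · rw [hEP] at hz
      obtain ⟨j, hj⟩ := hz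
      exact Or.inr ⟨j, j.2, by rw [dif_pos j.2]; exact Subtype.ext hj⟩

end IsOddHole.IsTraversal

end Graph

/-! ### Imperfection of the line graphs -/

namespace Graph

variable {α β : Type*} {H : Graph α β}

theorem IsOddHoleWithDoubleEdge.isNPlusImperfect (hH : H.IsOddHoleWithDoubleEdge) :
    H.lineGraph.IsNPlusImperfect := by
  obtain ⟨C, hCH, hC, d, x, y, hd, hadj, hlink, -, hE⟩ := hH
  have hxy : x ≠ y := by
    rintro rfl
    obtain ⟨k, hk, w, e, hw, he, -, hCE, hCl⟩ := hC
    obtain ⟨b, hb⟩ := hadj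
    have hbE := hb.edge_mem
    rw [hCE] at hbE
    obtain ⟨i, rfl⟩ := hbE
    have : Fact (1 < 2 * k + 1) := ⟨by omega⟩
    have h0 : w i = w (i + 1) := by
      rcases hb.eq_and_eq_or_eq_and_eq (hCl i) with ⟨h1, h2⟩ | ⟨h1, h2⟩
      · exact h1.symm.trans h2
      · exact h2.symm.trans h1
    exact one_ne_zero (left_eq_add.1 (hw h0))
  obtain ⟨k, hk, m, v, e, hT⟩ := hC.exists_isTraversal hadj.left_mem hadj.right_mem hxy
  obtain ⟨p, e, f, hθ⟩ := hT.isTheta_of_edge hCH hd hlink hE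
  obtain ⟨k, rfl⟩ := Nat.exists_eq_add_of_le' hk
  rw [hT.adj_iff.1 hadj] at hθ
  exact hθ.isNPlusImperfect_of_one (r := 0)

lemma IsOddHole.IsTraversal.isNPlusImperfect_of_not_adj {C : Graph α β} {x y : α} {k m l : ℕ}
    {v : ℕ → α} {e : ℕ → β} (hT : IsOddHole.IsTraversal C x y k m v e) (hadj : ¬ C.Adj x y)
    (hl : Odd l) {p : ℕ → α} {e f : ℕ → E(H)} (hθ : H.IsTheta (2 * k + 1) m l v p e f) :
    H.lineGraph.IsNPlusImperfect := by
  have hm1 : m ≠ 1 := mt hT.adj_iff.2 hadj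
  have hlt := hT.m_lt
  obtain ⟨c, rfl⟩ := hT.odd
  obtain ⟨r, rfl⟩ := hl
  obtain ⟨a, rfl⟩ : ∃ a, c = a + 1 := Nat.exists_eq_succ_of_ne_zero (by omega)
  obtain ⟨b, rfl⟩ : ∃ b, k = a + b + 2 := ⟨k - (a + 2), by omega⟩
  exact hθ.isNPlusImperfect_of_three_le

theorem IsOddHoleWithChord.isNPlusImperfect (hH : H.IsOddHoleWithChord) :
    H.lineGraph.IsNPlusImperfect := by
  obtain ⟨C, hCH, hC, c, x, y, hc, hx, hy, hxy, hadj, hlink, -, hE⟩ := hH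
  obtain ⟨k, hk, m, v, e, hT⟩ := hC.exists_isTraversal hx hy hxy
  obtain ⟨p, e, f, hθ⟩ := hT.isTheta_of_edge hCH hc hlink hE
  exact hT.isNPlusImperfect_of_not_adj hadj odd_one hθ

theorem IsOddHoleWithOddPath.isNPlusImperfect (hH : H.IsOddHoleWithOddPath) :
    H.lineGraph.IsNPlusImperfect := by
  obtain ⟨C, P, hCH, hPH, hC, l, x, y, hl, hP, hx, hy, hxy, hadj, hV, hdisj, -, hE⟩ := hH
  obtain ⟨k, hk, m, v, e, hT⟩ := hC.exists_isTraversal hx hy hxy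
  obtain ⟨p, e, f, hθ⟩ := hT.isTheta_of_path hCH hPH hl.pos hP hV hdisj hE
  exact hT.isNPlusImperfect_of_not_adj hadj hl hθ

end Graph

theorem mainTheorem3 {α β : Type*} (H : Graph α β)
    (hH : H.IsOddHoleWithDoubleEdge ∨ H.IsOddHoleWithChord ∨ H.IsOddHoleWithOddPath) :
    H.lineGraph.IsNPlusImperfect := by
  rcases hH with h | h | h
  exacts [h.isNPlusImperfect, h.isNPlusImperfect, h.isNPlusImperfect]
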